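/- Let $G$ be a finite simple planar graph that contains no kite, i.e. no two distinct 3-cycles that share an edge. Write $d(v)$ for the degree of a vertex $v$ and $\Delta$ for the maximum degree of $G$. If $\Delta\le 5$ and $G$ has at least one edge, then $G$ has an edge $uv$ with $d(u)+d(v)\le 8$. If $\Delta=6$, then $G$ has an edge $uv$ with $d(u)+d(v)\le 9$. -/

import Mathlib

/-- `A` is a polygonal arc in the plane with ends `a` and `b`: a union of finitely many
nondegenerate segments `[p 0, p 1], [p 1, p 2], …, [p (n - 1), p n]` with `p 0 = a` and `p n = b`
that does not meet itself, i.e. two different segments of the chain have no common point, except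
that consecutive segments share the corner at which they are joined. -/
def IsPolygonalArc (A : Set (ℝ × ℝ)) (a b : ℝ × ℝ) : Prop :=
  ∃ (n : ℕ) (p : ℕ → ℝ × ℝ),
    0 < n ∧ p 0 = a ∧ p n = b ∧
    A = {x | ∃ i < n, x ∈ segment ℝ (p i) (p (i + 1))} ∧
    (∀ i < n, p i ≠ p (i + 1)) ∧
    ∀ i j, i < j → j < n → ∀ x, x ∈ segment ℝ (p i) (p (i + 1)) →
      x ∈ segment ℝ (p j) (p (j + 1)) → j = i + 1 ∧ x = p j

namespace SimpleGraph

/-- A drawing of the graph `G` in the plane without crossings: distinct vertices are distinct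
points, the edge `uv` is a polygonal arc joining the points of `u` and `v`, an edge passes through
no vertex other than its two ends, and two different edges meet only in common ends. -/
structure PlaneDrawing {V : Type*} (G : SimpleGraph V) where
  point : V → ℝ × ℝ
  arc : Sym2 V → Set (ℝ × ℝ)
  point_injective : Function.Injective point
  isPolygonalArc : ∀ u v, G.Adj u v → IsPolygonalArc (arc s(u, v)) (point u) (point v)
  mem_of_point_mem : ∀ e ∈ G.edgeSet, ∀ w, point w ∈ arc e → w ∈ e
  eq_point_of_mem : ∀ e ∈ G.edgeSet, ∀ f ∈ G.edgeSet, e ≠ f → ∀ x, x ∈ arc e → x ∈ arc f →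
    ∃ w, w ∈ e ∧ w ∈ f ∧ x = point w

/-- A graph is planar if it can be drawn in the plane without crossings. -/
def IsPlanar {V : Type*} (G : SimpleGraph V) : Prop :=
  Nonempty G.PlaneDrawing

/-- `G` contains a kite: two (different) 3-cycles `u v w` and `u v x` that share an edge `uv`. -/
def HasKite {V : Type*} (G : SimpleGraph V) : Prop :=
  ∃ u v w x, w ≠ x ∧ G.Adj u v ∧ G.Adj u w ∧ G.Adj v w ∧ G.Adj u x ∧ G.Adj v x

end SimpleGraph

/-! The proof is by discharging. If no edge is light, every nonisolated vertex has degree 4, 5 or 6.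
Give each such vertex the charge d - 4 and each face its length minus 4. With E < F + V', where V'
counts nonisolated vertices, the sum 4(E - V' - F) is negative. Only triangular faces start
negative, with charge -1. Without kites no two of them share an edge, so at most d/2 meet at a
vertex. A 5-vertex can thus give 1/2, and a 6-vertex 2/3, to each triangular face at it, and the
degree sums on the three edges ensure that each triangle receives at least 1. So the total is
nonnegative, a contradiction (`PlaneRotation.isEmpty_dart`).

The inequality E < F + V' needs no Jordan curve theorem. An antisymmetric weight on darts satisfying
Kirchhoff's law at every vertex has winding numbers, which are constant along each face walk and
differ across an edge by its weight (`nonempty_planeRotation`). Hence the space of circulations, of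
dimension at least E - V', lies in the image of the face functions, of dimension at most F - 1,
constants being lost (`card_edges_lt`). The winding number is the sum of the angles under which the
segments are seen. It is tracked only along segments and around their ends (`total_pt_eq`,
`left_inv_eq`), and faces are combinatorial orbits. -/

open Complex in
-- A quotient `-r` with `r ≥ 0` would make `x` the convex combination of `a` and `b` with weights `r
-- / (1 + r)` and `1 / (1 + r)`. So the angle under which a segment is seen jumps only on the
-- segment itself.
theorem Complex.div_mem_slitPlane_of_notMem_segment {a b x : ℂ} (h : x ∉ segment ℝ a b) :
    (b - x) / (a - x) ∈ slitPlane := by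
  have ha : a - x ≠ 0 := by
    intro h0
    rw [sub_eq_zero] at h0
    exact h (h0 ▸ left_mem_segment ℝ a b)
  by_contra hs
  rw [mem_slitPlane_iff] at hs
  push Not at hs
  obtain ⟨hre, him⟩ := hs
  set r := -((b - x) / (a - x)).re with hr
  have hr0 : 0 ≤ r := by linarith
  have heq : (b - x) / (a - x) = -(r : ℂ) := by
    apply Complex.ext <;> simp [hr, him]
  rw [div_eq_iff ha] at heq
  apply h
  have h1 : (1 + r : ℝ) ≠ 0 := by positivity
  have h1' : (1 + r : ℂ) ≠ 0 := by exact_mod_cast h1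
  refine ⟨r / (1 + r), 1 / (1 + r), by positivity, by positivity,
    by field_simp; ring, ?_⟩
  simp only [real_smul]
  push_cast
  field_simp
  linear_combination heq

/-! ### Angles in (0, 2π] -/

namespace Complex

/-- The angle of `z`, normalised to lie in `(0, 2π]`. -/
noncomputable def posArg (z : ℂ) : ℝ := arg (-z) + Real.pi

theorem posArg_pos (z : ℂ) : 0 < posArg z := by
  unfold posArg; linarith [neg_pi_lt_arg (-z)]

theorem posArg_le (z : ℂ) : posArg z ≤ 2 * Real.pi := by
  unfold posArg; linarith [arg_le_pi (-z)]

/-- With 2π instead of 0, a direction comes last in the counterclockwise order that starts from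
itself, so minimising the angle finds the next direction. -/
theorem posArg_one : posArg 1 = 2 * Real.pi := by
  unfold posArg; rw [arg_neg_one]; ring

theorem norm_mul_exp_posArg (z : ℂ) : (‖z‖ : ℂ) * exp (posArg z * I) = z := by
  have h := norm_mul_exp_arg_mul_I (-z)
  unfold posArg
  push_cast
  rw [add_mul, exp_add, exp_pi_mul_I]
  rw [norm_neg] at h
  linear_combination -h

theorem posArg_eq_of_norm_mul_exp {r t : ℝ} (hr : 0 < r) (ht : 0 < t) (ht' : t ≤ 2 * Real.pi) :
    posArg (r * exp (t * I)) = t := by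
  unfold posArg
  have : -((r : ℂ) * exp (t * I)) = r * exp ((t - Real.pi : ℝ) * I) := by
    push_cast
    rw [sub_mul, exp_sub, exp_pi_mul_I]
    ring
  rw [this, arg_real_mul _ hr, exp_mul_I, ← ofReal_cos, ← ofReal_sin, ofReal_cos, ofReal_sin,
    arg_cos_add_sin_mul_I]
  · ring
  · constructor <;> linarith

theorem div_eq_of_posArg (z w : ℂ) :
    z / w = ((‖z‖ / ‖w‖ : ℝ) : ℂ) * exp ((posArg z - posArg w : ℝ) * I) := by
  conv_lhs => rw [← norm_mul_exp_posArg z, ← norm_mul_exp_posArg w]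
  push_cast
  rw [sub_mul, exp_sub]
  exact mul_div_mul_comm _ _ _ _

theorem posArg_div_of_lt {z w : ℂ} (hz : z ≠ 0) (hw : w ≠ 0) (h : posArg w < posArg z) :
    posArg (z / w) = posArg z - posArg w := by
  rw [div_eq_of_posArg z w]
  apply posArg_eq_of_norm_mul_exp
  · have := norm_pos_iff.2 hz; have := norm_pos_iff.2 hw; positivity
  · linarith
  · linarith [posArg_le z, posArg_pos w]

theorem div_eq_ofReal_of_posArg_eq {z w : ℂ} (hz : z ≠ 0) (hw : w ≠ 0)
    (h : posArg w = posArg z) : ∃ r : ℝ, 0 < r ∧ z / w = r := by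
  refine ⟨‖z‖ / ‖w‖, ?_, ?_⟩
  · have := norm_pos_iff.2 hz; have := norm_pos_iff.2 hw; positivity
  · rw [div_eq_of_posArg z w, h]; simp

end Complex

/-! ### Segment systems and viewing angles -/

/-- A system of straight segments in the plane, each listed with both orientations. The oriented
segment `i` starts at `src i` and `inv i` is its reversal. Two segments meet in common ends only. -/
structure SegmentSystem (ι : Type*) where
  src : ι → ℂ
  inv : ι → ι
  inv_inv : ∀ i, inv (inv i) = i
  src_ne : ∀ i, src i ≠ src (inv i)
  cross : ∀ i j x, x ∈ segment ℝ (src i) (src (inv i)) → x ∈ segment ℝ (src j) (src (inv j)) →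
    j = i ∨ j = inv i ∨ ((x = src i ∨ x = src (inv i)) ∧ (x = src j ∨ x = src (inv j)))

namespace SegmentSystem

open Complex Filter Topology

variable {ι : Type*} (S : SegmentSystem ι)

/-- The vector from the start of an oriented segment to its end. -/
def dir (i : ι) : ℂ := S.src (S.inv i) - S.src i

theorem dir_ne_zero (i : ι) : S.dir i ≠ 0 := sub_ne_zero.2 (S.src_ne i).symm

theorem dir_inv (i : ι) : S.dir (S.inv i) = -S.dir i := by
  unfold dir; rw [S.inv_inv]; ring

/-- The signed angle under which the oriented segment `j` is seen from `x`. -/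
noncomputable def view (j : ι) (x : ℂ) : ℝ := arg ((S.src (S.inv j) - x) / (S.src j - x))

/-- The point of the segment `i` with parameter `t`. -/
noncomputable def pt (i : ι) (t : ℝ) : ℂ := S.src i + t * S.dir i

theorem pt_mem (i : ι) {t : ℝ} (h0 : 0 ≤ t) (h1 : t ≤ 1) :
    S.pt i t ∈ segment ℝ (S.src i) (S.src (S.inv i)) := by
  refine ⟨1 - t, t, by linarith, h0, by ring, ?_⟩
  simp only [real_smul, pt, dir]; push_cast; ring

theorem pt_ne_src (i : ι) {t : ℝ} (h0 : 0 < t) : S.pt i t ≠ S.src i := by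
  unfold pt
  have := S.dir_ne_zero i
  have ht : (t : ℂ) ≠ 0 := by exact_mod_cast h0.ne'
  simp [this, h0.ne']

theorem pt_inv (i : ι) (t : ℝ) : S.pt (S.inv i) t = S.pt i (1 - t) := by
  unfold pt; rw [dir_inv]; unfold dir; push_cast; ring

theorem pt_ne_src_inv (i : ι) {t : ℝ} (h1 : t < 1) : S.pt i t ≠ S.src (S.inv i) := by
  have := S.pt_ne_src (S.inv i) (t := 1 - t) (by linarith)
  rwa [pt_inv, sub_sub_cancel] at this

theorem pt_notMem (i j : ι) (hi : j ≠ i) (hi' : j ≠ S.inv i) {t : ℝ} (h0 : 0 < t) (h1 : t < 1) :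
    S.pt i t ∉ segment ℝ (S.src j) (S.src (S.inv j)) := by
  intro h
  rcases S.cross i j _ (S.pt_mem i h0.le h1.le) h with h | h | ⟨h | h, -⟩
  · exact hi h
  · exact hi' h
  · exact S.pt_ne_src i h0 h
  · exact S.pt_ne_src_inv i h1 h

/-- Both orientations give π, so under an antisymmetric weight the segment contributes nothing to
the total at its own inner points. -/
theorem view_self (i : ι) {t : ℝ} (h0 : 0 < t) (h1 : t < 1) : S.view i (S.pt i t) = Real.pi := by
  unfold view
  rw [arg_eq_pi_iff]
  have : (S.src (S.inv i) - S.pt i t) / (S.src i - S.pt i t) = ((-((1 - t) / t) : ℝ) : ℂ) := by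
    have := S.dir_ne_zero i
    have ht : (t : ℂ) ≠ 0 := by exact_mod_cast h0.ne'
    have e1 : S.src (S.inv i) - S.pt i t = (1 - t) * S.dir i := by unfold pt dir; ring
    have e2 : S.src i - S.pt i t = -t * S.dir i := by unfold pt; ring
    rw [e1, e2]; push_cast; field_simp
  rw [this]
  refine ⟨?_, ofReal_im _⟩
  rw [ofReal_re]
  have : 0 < (1 - t) / t := div_pos (by linarith) h0
  linarith

theorem view_inv_self (i : ι) {t : ℝ} (h0 : 0 < t) (h1 : t < 1) :
    S.view (S.inv i) (S.pt i t) = Real.pi := by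
  have := S.view_self (S.inv i) (t := 1 - t) (by linarith) (by linarith)
  rwa [pt_inv, sub_sub_cancel] at this

theorem hasDerivAt_pt (i : ι) (t : ℝ) : HasDerivAt (S.pt i) (S.dir i) t := by
  unfold pt
  simpa using ((hasDerivAt_id t).ofReal_comp.mul_const (S.dir i)).const_add (S.src i)

/-- Off segment `j` the view is the imaginary part of a differentiable logarithm. On the segment
itself it is constant, and both terms of the formula are imaginary parts of reals. -/
theorem hasDerivAt_view (i j : ι) {t : ℝ} (h0 : 0 < t) (h1 : t < 1) :
    HasDerivAt (fun t => S.view j (S.pt i t))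
      ((S.dir i / (S.src j - S.pt i t)).im -
        (S.dir i / (S.src (S.inv j) - S.pt i t)).im) t := by
  have hd := S.dir_ne_zero i
  have ht : (t : ℂ) ≠ 0 := by exact_mod_cast h0.ne'
  have ht1 : (1 - t : ℂ) ≠ 0 := by
    have : (1 - t : ℝ) ≠ 0 := by linarith
    exact_mod_cast this
  have e1 : S.src (S.inv i) - S.pt i t = (1 - t) * S.dir i := by unfold pt dir; ring
  have e2 : S.src i - S.pt i t = -t * S.dir i := by unfold pt; ring
  have f1 : (S.dir i / (S.src (S.inv i) - S.pt i t)).im = 0 := by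
    have : S.dir i / (S.src (S.inv i) - S.pt i t) = ((1 / (1 - t) : ℝ) : ℂ) := by
      rw [e1]; push_cast; field_simp
    rw [this, ofReal_im]
  have f2 : (S.dir i / (S.src i - S.pt i t)).im = 0 := by
    have : S.dir i / (S.src i - S.pt i t) = ((-(1 / t) : ℝ) : ℂ) := by
      rw [e2]; push_cast; field_simp
    rw [this, ofReal_im]
  have hev : ∀ᶠ s in 𝓝 t, s ∈ Set.Ioo (0 : ℝ) 1 := Ioo_mem_nhds h0 h1
  by_cases hi : j = i
  · subst hi
    rw [f1, f2, sub_zero]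
    refine (hasDerivAt_const t Real.pi).congr_of_eventuallyEq ?_
    filter_upwards [hev] with s hs using S.view_self j hs.1 hs.2
  by_cases hi' : j = S.inv i
  · subst hi'
    rw [S.inv_inv, f1, f2, sub_zero]
    refine (hasDerivAt_const t Real.pi).congr_of_eventuallyEq ?_
    filter_upwards [hev] with s hs using S.view_inv_self i hs.1 hs.2
  have hn := S.pt_notMem i j hi hi' h0 h1
  have hs := div_mem_slitPlane_of_notMem_segment hn
  have ha : S.src j - S.pt i t ≠ 0 := by
    intro h; rw [sub_eq_zero] at h; exact hn (h ▸ left_mem_segment ℝ _ _)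
  have hb : S.src (S.inv j) - S.pt i t ≠ 0 := by
    intro h; rw [sub_eq_zero] at h; exact hn (h ▸ right_mem_segment ℝ _ _)
  have hx := S.hasDerivAt_pt i t
  have hq := ((hx.const_sub (S.src (S.inv j))).div (hx.const_sub (S.src j)) ha).clog_real hs
  have hr := (imCLM.hasFDerivAt.comp_hasDerivAt t hq)
  refine (hr.congr_deriv ?_).congr_of_eventuallyEq ?_
  · rw [← sub_im]
    simp only [imCLM_apply]
    congr 1
    simp only [Pi.div_apply]
    field_simp
    ring
  · filter_upwards with s
    simp [view, log_im]

variable [Fintype ι]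

/-- A circulation: an antisymmetric weight on the oriented segments such that at each point the
weights of the segments that start there add up to zero. -/
structure IsCirculation (z : ι → ℝ) : Prop where
  antisymm : ∀ i, z (S.inv i) = -z i
  sum_eq_zero : ∀ g : ℂ → ℝ, ∑ i, z i * g (S.src i) = 0

theorem sum_inv (f : ι → ℝ) : ∑ i, f (S.inv i) = ∑ i, f i :=
  Equiv.sum_comp (Function.Involutive.toPerm S.inv S.inv_inv) f

/-- The total angle under which a weighted system of segments is seen from `x`. -/
noncomputable def total (z : ι → ℝ) (x : ℂ) : ℝ := ∑ j, z j * S.view j x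

variable {S} {z : ι → ℝ}

/-- The derivative of each view is a difference of one function at the two ends of the segment.
Summed with the weights, both halves vanish by Kirchhoff's law, the second after reversing all
segments. -/
theorem IsCirculation.total_pt_eq (hz : S.IsCirculation z) (i : ι) {s t : ℝ}
    (hs : s ∈ Set.Ioo (0 : ℝ) 1) (ht : t ∈ Set.Ioo (0 : ℝ) 1) :
    S.total z (S.pt i s) = S.total z (S.pt i t) := by
  have key : ∀ t ∈ Set.Ioo (0 : ℝ) 1, HasDerivAt (fun t => S.total z (S.pt i t)) 0 t := by
    intro t ht
    have h := HasDerivAt.fun_sum (u := Finset.univ)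
      (fun j _ => (S.hasDerivAt_view i j ht.1 ht.2).const_mul (z j))
    refine h.congr_deriv ?_
    have h1 := hz.sum_eq_zero (fun p => (S.dir i / (p - S.pt i t)).im)
    have h2 := S.sum_inv (fun j => z j * (S.dir i / (S.src j - S.pt i t)).im)
    simp only [hz.antisymm, neg_mul, Finset.sum_neg_distrib] at h2
    simp only [mul_sub, Finset.sum_sub_distrib]
    linarith
  exact isOpen_Ioo.is_const_of_deriv_eq_zero isPreconnected_Ioo
    (fun t ht => (key t ht).differentiableAt.differentiableWithinAt)
    (fun t ht => (key t ht).deriv) hs ht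

end SegmentSystem

/-! ### Winding numbers beside a segment and around its start -/

namespace SegmentSystem

open Complex Filter Topology

variable {ι : Type*} {S : SegmentSystem ι}

theorem eq_of_dir_div_dir_eq {i j : ι} (h : S.src i = S.src j) {r : ℝ} (hr : 0 < r)
    (hd : S.dir j / S.dir i = r) : j = i := by
  wlog hr1 : r ≤ 1 generalizing i j r
  · refine (this h.symm (inv_pos.2 hr) ?_ (inv_le_one_of_one_le₀ (by linarith))).symm
    rw [← inv_div, hd, ofReal_inv]
  rw [div_eq_iff (S.dir_ne_zero i)] at hd
  have e : S.src (S.inv j) = S.pt i r := by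
    have : S.src (S.inv j) = S.src j + S.dir j := by unfold dir; ring
    rw [this, hd, pt, h]
  have hm := S.pt_mem i hr.le hr1
  rw [← e] at hm
  rcases S.cross i j _ hm (right_mem_segment ℝ _ _) with h' | h' | ⟨h' | h', -⟩
  · exact h'
  · exact absurd (h.trans (h' ▸ rfl)) (S.src_ne i)
  · exact absurd h' (e ▸ S.pt_ne_src i hr)
  -- The segments have both ends in common, so their common midpoint decides.
  · have hm' := S.cross j i (S.pt j (1 / 2)) (S.pt_mem j (by norm_num) (by norm_num)) (by
      have := S.pt_mem i (t := 1 / 2) (by norm_num) (by norm_num)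
      rwa [show S.pt j (1 / 2) = S.pt i (1 / 2) by unfold pt dir; rw [h', h]])
    rcases hm' with h'' | h'' | ⟨h'' | h'', -⟩
    · exact h''.symm
    · exact absurd (h''▸ h.symm) (S.src_ne j)
    · exact absurd h'' (S.pt_ne_src j (by norm_num))
    · exact absurd h'' (S.pt_ne_src_inv j (by norm_num))

/-- The angle by which the oriented segment `i` is turned to the direction of `j`. -/
noncomputable def angle (S : SegmentSystem ι) (i j : ι) : ℝ := posArg (S.dir j / S.dir i)

theorem angle_le (i j : ι) : S.angle i j ≤ 2 * Real.pi := posArg_le _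

theorem angle_self (i : ι) : S.angle i i = 2 * Real.pi := by
  rw [angle, div_self (S.dir_ne_zero i), posArg_one]

theorem angle_ne {i j k : ι} (hj : S.src i = S.src j) (hk : S.src i = S.src k) (h : k ≠ j) :
    S.angle i j ≠ S.angle i k := by
  intro he
  obtain ⟨r, hr, hd⟩ := div_eq_ofReal_of_posArg_eq
    (div_ne_zero (S.dir_ne_zero k) (S.dir_ne_zero i))
    (div_ne_zero (S.dir_ne_zero j) (S.dir_ne_zero i)) he
  rw [div_div_div_cancel_right₀ (S.dir_ne_zero i)] at hd
  exact h (eq_of_dir_div_dir_eq (hj.symm.trans hk) hr hd)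

theorem angle_of_lt {i j k : ι} (h : S.angle i j < S.angle i k) :
    S.angle j k = S.angle i k - S.angle i j := by
  have := posArg_div_of_lt (div_ne_zero (S.dir_ne_zero k) (S.dir_ne_zero i))
    (div_ne_zero (S.dir_ne_zero j) (S.dir_ne_zero i)) h
  rwa [div_div_div_cancel_right₀ (S.dir_ne_zero i)] at this

theorem notMem_of_src_ne (i j : ι) (h : S.src j ≠ S.src i) (h' : S.src (S.inv j) ≠ S.src i) :
    S.src i ∉ segment ℝ (S.src j) (S.src (S.inv j)) := by
  intro hm
  rcases S.cross i j _ (left_mem_segment ℝ _ _) hm with h1 | h1 | ⟨-, h1 | h1⟩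
  · exact h (h1 ▸ rfl)
  · exact h' (by rw [h1, S.inv_inv])
  · exact h h1.symm
  · exact h' h1.symm

theorem tendsto_pt (i : ι) : Tendsto (S.pt i) (𝓝[>] 0) (𝓝 (S.src i)) := by
  have := (S.hasDerivAt_pt i 0).continuousAt.tendsto
  rw [show S.pt i 0 = S.src i by simp [pt]] at this
  exact this.mono_left nhdsWithin_le_nhds

theorem neg_div_mem_slitPlane {i j : ι} (h : S.src j = S.src i) (hij : j ≠ i) :
    -(S.dir j / S.dir i) ∈ slitPlane := by
  by_contra hs
  rw [mem_slitPlane_iff] at hs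
  push Not at hs
  obtain ⟨h1, h2⟩ := hs
  rw [neg_re] at h1
  rw [neg_im, neg_eq_zero] at h2
  have e : S.dir j / S.dir i = ((S.dir j / S.dir i).re : ℂ) := Complex.ext rfl (by simp [h2])
  refine hij (eq_of_dir_div_dir_eq h.symm (lt_of_le_of_ne (by linarith) ?_) e)
  intro h0
  rw [← h0, ofReal_zero] at e
  exact div_ne_zero (S.dir_ne_zero j) (S.dir_ne_zero i) e

theorem tendsto_view_of_ne {i j : ι} (h : S.src j ≠ S.src i) (h' : S.src (S.inv j) ≠ S.src i) :
    Tendsto (fun t => S.view j (S.pt i t)) (𝓝[>] 0) (𝓝 (S.view j (S.src i))) := by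
  have hs := div_mem_slitPlane_of_notMem_segment (S.notMem_of_src_ne i j h h')
  exact (continuousAt_arg hs).tendsto.comp
    ((tendsto_const_nhds.sub (S.tendsto_pt i)).div (tendsto_const_nhds.sub (S.tendsto_pt i))
      (sub_ne_zero.2 h))

theorem tendsto_view_of_src_eq {i j : ι} (h : S.src j = S.src i) :
    Tendsto (fun t => S.view j (S.pt i t)) (𝓝[>] 0) (𝓝 (arg (-(S.dir j / S.dir i)))) := by
  by_cases hij : j = i
  · subst hij
    rw [div_self (S.dir_ne_zero j), arg_neg_one]
    refine tendsto_const_nhds.congr' ?_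
    filter_upwards [Ioo_mem_nhdsGT (zero_lt_one' ℝ)] with t ht
    exact (S.view_self j ht.1 ht.2).symm
  have hs := neg_div_mem_slitPlane h hij
  have h1 : Tendsto (fun t => -((S.src (S.inv j) - S.pt i t) / S.dir i)) (𝓝[>] 0)
      (𝓝 (-(S.dir j / S.dir i))) := by
    have := ((tendsto_const_nhds (x := S.src (S.inv j))).sub (S.tendsto_pt i)).div_const (S.dir i)
    rw [← h] at this
    exact this.neg
  refine ((continuousAt_arg hs).tendsto.comp h1).congr' ?_
  filter_upwards [self_mem_nhdsWithin] with t ht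
  have ht : 0 < t := ht
  have hd := S.dir_ne_zero i
  have ht' : (t : ℂ) ≠ 0 := by exact_mod_cast ht.ne'
  have e : -((S.src (S.inv j) - S.pt i t) / S.dir i)
      = t * ((S.src (S.inv j) - S.pt i t) / (S.src j - S.pt i t)) := by
    have : S.src j - S.pt i t = -t * S.dir i := by rw [h]; unfold pt; ring
    rw [this]; field_simp
  rw [Function.comp_apply, e, arg_real_mul _ ht, view]

theorem tendsto_view_of_src_inv_eq {i j : ι} (h : S.src j = S.src i) (hij : j ≠ i) :
    Tendsto (fun t => S.view (S.inv j) (S.pt i t)) (𝓝[>] 0)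
      (𝓝 (-arg (-(S.dir j / S.dir i)))) := by
  have h1 := tendsto_view_of_src_eq h
  refine h1.neg.congr' ?_
  filter_upwards [Ioo_mem_nhdsGT (zero_lt_one' ℝ)] with t ht
  by_cases hij' : j = S.inv i
  · exact absurd (h.symm.trans (hij' ▸ rfl)) (S.src_ne i)
  have := div_mem_slitPlane_of_notMem_segment (S.pt_notMem i j hij hij' ht.1 ht.2)
  unfold view
  rw [S.inv_inv, ← inv_div (S.src (S.inv j) - S.pt i t), arg_inv, if_neg (slitPlane_arg_ne_pi this)]

/-- The cyclic successor around a point where at least three segments start has no 2-cycle. -/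
theorem eq_of_angle_le {i j k : ι} (hj : S.src i = S.src j) (hk : S.src i = S.src k)
    (hij : j ≠ i) (hkj : k ≠ j) (h1 : S.angle i j ≤ S.angle i k)
    (h2 : S.angle j i ≤ S.angle j k) : k = i := by
  by_contra hki
  have a1 := angle_of_lt (lt_of_le_of_ne h1 (angle_ne hj hk hkj))
  have a2 := angle_of_lt (lt_of_le_of_ne (S.angle_self i ▸ S.angle_le i j)
    (angle_ne hj rfl hij.symm))
  have a3 := lt_of_le_of_ne (S.angle_self i ▸ S.angle_le i k) (angle_ne hk rfl (Ne.symm hki))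
  linarith

variable [Fintype ι] {z : ι → ℝ}

/-- The multiple of the winding number of the circulation `z` around the points that are just to
the left of the oriented segment `i`. -/
noncomputable def left (S : SegmentSystem ι) (z : ι → ℝ) (i : ι) : ℝ :=
  S.total z (S.pt i (1 / 2)) / 2 + Real.pi * z i

/-- The total counts every segment twice, hence the division by 2. Moving off segment `i` to its
left turns the reversed view from π to -π, which adds `π * z i` to the half total. -/
theorem IsCirculation.left_sub_left_inv (hz : S.IsCirculation z) (i : ι) :
    S.left z i - S.left z (S.inv i) = 2 * Real.pi * z i := by
  unfold left
  rw [pt_inv, hz.antisymm, show (1 : ℝ) - 1 / 2 = 1 / 2 by norm_num]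
  ring

-- Obtained by letting a point of segment `i` tend to `p`. Segments not ending at `p` have
-- continuous views and form the constant, which is independent of `i`. The others contribute their
-- directions relative to `i`.
open Classical in
theorem IsCirculation.exists_left_eq (hz : S.IsCirculation z) (p : ℂ) :
    ∃ K : ℝ, ∀ i, S.src i = p →
      S.left z i = K + ∑ j with S.src j = p, z j * S.angle i j := by
  refine ⟨(∑ j with S.src j ≠ p ∧ S.src (S.inv j) ≠ p, z j * S.view j p) / 2, fun i hi => ?_⟩
  subst hi
  have hlim : ∀ j, Tendsto (fun t => S.view j (S.pt i t)) (𝓝[>] 0) (𝓝 (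
      (if S.src j ≠ S.src i ∧ S.src (S.inv j) ≠ S.src i then S.view j (S.src i) else 0) +
      (if S.src j = S.src i then arg (-(S.dir j / S.dir i)) else 0) +
      (if S.src (S.inv j) = S.src i then
        (if S.inv j = i then Real.pi else -arg (-(S.dir (S.inv j) / S.dir i))) else 0))) := by
    intro j
    by_cases h1 : S.src j = S.src i
    · have h2 : S.src (S.inv j) ≠ S.src i := h1 ▸ (S.src_ne j).symm
      simpa [h1, h2] using tendsto_view_of_src_eq h1
    by_cases h2 : S.src (S.inv j) = S.src i
    · by_cases h3 : S.inv j = i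
      · have h4 : j = S.inv i := by rw [← h3, S.inv_inv]
        simp only [h1, h3, ne_eq, not_true_eq_false, and_false, if_false, if_true, zero_add]
        refine tendsto_const_nhds.congr' ?_
        filter_upwards [Ioo_mem_nhdsGT (zero_lt_one' ℝ)] with t ht
        rw [h4, S.view_inv_self i ht.1 ht.2]
      · have := tendsto_view_of_src_inv_eq h2 h3
        rw [S.inv_inv] at this
        simpa [h1, h2, h3] using this
    · simpa [h1, h2] using tendsto_view_of_ne h1 h2
  have hsum := tendsto_finsetSum Finset.univ (fun j _ => (hlim j).const_mul (z j))
  have hconst : Tendsto (fun t => ∑ j, z j * S.view j (S.pt i t)) (𝓝[>] 0)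
      (𝓝 (S.total z (S.pt i (1 / 2)))) := by
    refine tendsto_const_nhds.congr' ?_
    filter_upwards [Ioo_mem_nhdsGT (zero_lt_one' ℝ)] with t ht
    exact hz.total_pt_eq i (by norm_num) ht
  have heq := tendsto_nhds_unique hconst hsum
  -- Segments that end at `p` are reversed to start there. Both weight and angle change sign, except
  -- that the reversal of `i` keeps the angle π; this exception costs `2π * z i`, which the term `π
  -- * z i` in `left` makes up for.
  have h3 := S.sum_inv (fun j => -(z j * (if S.src j = S.src i then
        (if j = i then Real.pi else -arg (-(S.dir j / S.dir i))) else 0)))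
  simp only [hz.antisymm, neg_mul, neg_neg] at h3
  have h4 : ∑ j, -(z j * (if S.src j = S.src i then
        (if j = i then Real.pi else -arg (-(S.dir j / S.dir i))) else 0))
      = ∑ j, z j * (if S.src j = S.src i then arg (-(S.dir j / S.dir i)) else 0)
        - 2 * Real.pi * z i := by
    have h5 : 2 * Real.pi * z i = ∑ j, if j = i then 2 * Real.pi * z j else 0 := by simp
    rw [h5, ← Finset.sum_sub_distrib]
    refine Finset.sum_congr rfl fun j _ => ?_
    by_cases h6 : j = i
    · subst h6
      simp only [if_true, div_self (S.dir_ne_zero j), arg_neg_one]; ring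
    · by_cases h7 : S.src j = S.src i <;> simp [h6, h7]
  have h8 : ∑ j with S.src j = S.src i, z j * S.angle i j =
      ∑ j, z j * (if S.src j = S.src i then arg (-(S.dir j / S.dir i)) else 0) := by
    -- The shift by π between `arg` and `posArg` cancels by Kirchhoff's law at `p`.
    have h9 := hz.sum_eq_zero (fun p => if p = S.src i then Real.pi else 0)
    rw [Finset.sum_filter, ← sub_eq_zero, ← Finset.sum_sub_distrib]
    refine Eq.trans ?_ h9
    refine Finset.sum_congr rfl fun j _ => ?_
    unfold angle posArg
    split_ifs <;> ring
  simp only [mul_add, Finset.sum_add_distrib] at heq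
  rw [h3, h4] at heq
  rw [left, heq, h8, Finset.sum_filter]
  simp only [mul_ite, mul_zero]
  ring

/-- Turning around the start of `i` to the next segment `j` crosses no segment. -/
theorem IsCirculation.left_inv_eq (hz : S.IsCirculation z) {i j : ι} (h : S.src i = S.src j)
    (hmin : ∀ k, S.src i = S.src k → S.angle i j ≤ S.angle i k) :
    S.left z (S.inv j) = S.left z i := by
  classical
  obtain ⟨K, hK⟩ := hz.exists_left_eq (S.src i)
  have h1 := hz.left_sub_left_inv j
  have h2 : S.left z j = S.left z i + 2 * Real.pi * z j := by
    rw [hK i rfl, hK j h.symm, add_assoc]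
    congr 1
    -- Measured from `j` instead of `i`, all angles drop by `angle i j`, which Kirchhoff's law
    -- cancels; only that of `j` itself also gains 2π.
    have h3 := hz.sum_eq_zero (fun p => if p = S.src i then S.angle i j else 0)
    have h4 : 2 * Real.pi * z j = ∑ k, if k = j then 2 * Real.pi * z k else 0 := by simp
    rw [h4, Finset.sum_filter, Finset.sum_filter]
    refine ((add_zero _).symm.trans (congrArg _ h3.symm)).trans ?_
    rw [← Finset.sum_add_distrib, ← Finset.sum_add_distrib, ← sub_eq_zero,
      ← Finset.sum_sub_distrib]
    refine Finset.sum_eq_zero fun k _ => ?_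
    by_cases hk : k = j
    · subst hk
      simp only [h, if_true, angle_self]; ring
    by_cases hk' : S.src k = S.src i
    · have := angle_of_lt (lt_of_le_of_ne (hmin k hk'.symm) (angle_ne h hk'.symm hk))
      simp only [hk, hk', this, if_true, if_false]; ring
    · simp [hk, hk']
  linarith

end SegmentSystem

/-! ### From plane drawings to chains of corners -/

namespace SimpleGraph

open Complex

/-- A crossing-free drawing in the complex plane with polygonal arcs whose chains of corners are
given, for the two orientations of an edge in opposite orders. -/
structure PolygonalDrawing {V : Type*} (G : SimpleGraph V) where
  point : V → ℂ
  point_injective : Function.Injective point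
  len : G.Dart → ℕ
  corner : G.Dart → ℕ → ℂ
  len_pos : ∀ d, 0 < len d
  corner_zero : ∀ d, corner d 0 = point d.fst
  corner_len : ∀ d, corner d (len d) = point d.snd
  len_symm : ∀ d, len d.symm = len d
  corner_symm : ∀ d i, i ≤ len d → corner d.symm i = corner d (len d - i)
  corner_ne : ∀ d i, i < len d → corner d i ≠ corner d (i + 1)
  self_cross : ∀ d i j, i < j → j < len d → ∀ x, x ∈ segment ℝ (corner d i) (corner d (i + 1)) →
    x ∈ segment ℝ (corner d j) (corner d (j + 1)) → j = i + 1 ∧ x = corner d j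
  cross : ∀ d e, d.edge ≠ e.edge → ∀ i j, i < len d → j < len e → ∀ x,
    x ∈ segment ℝ (corner d i) (corner d (i + 1)) →
    x ∈ segment ℝ (corner e j) (corner e (j + 1)) → ∃ w, w ∈ d.edge ∧ w ∈ e.edge ∧ x = point w

variable {V : Type*} {G : SimpleGraph V}

/-- A symmetric choice along the two orientations of each edge. -/
theorem exists_dart_choice {α : Type*} (r : α → α) (p : G.Dart → α → Prop)
    (hp : ∀ d, ∃ a, p d a) (hr : ∀ d a, p d a → p d.symm (r a)) :
    ∃ f : G.Dart → α, (∀ d, p d (f d)) ∧ ∀ d, f d.symm = r (f d) ∨ f d = r (f d.symm) := by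
  classical
  -- An arbitrary order of the vertices singles out one orientation of each edge.
  let _ : LinearOrder V := linearOrderOfSTO WellOrderingRel
  choose g hg using hp
  have hsymm : ∀ d : G.Dart, p d (r (g d.symm)) := fun d => by
    have := hr _ _ (hg d.symm)
    rwa [Dart.symm_symm] at this
  refine ⟨fun d => if d.fst < d.snd then g d else r (g d.symm), fun d => ?_, fun d => ?_⟩
  · dsimp only
    split_ifs
    exacts [hg d, hsymm d]
  · have hne : d.fst ≠ d.snd := d.adj.ne
    have e1 : d.symm.fst = d.snd := rfl
    have e2 : d.symm.snd = d.fst := rfl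
    simp only [e1, e2, Dart.symm_symm]
    rcases lt_or_gt_of_ne hne with h | h
    · left; rw [if_pos h, if_neg h.le.not_gt]
    · right; rw [if_pos h, if_neg h.le.not_gt]

end SimpleGraph

section PolygonalChain

open SimpleGraph Complex

/-- The chain of corners of a polygonal arc, in the complex plane. -/
structure IsPolygonalChain (A : Set (ℝ × ℝ)) (a b : ℝ × ℝ) (c : ℕ × (ℕ → ℂ)) : Prop where
  pos : 0 < c.1
  start : c.2 0 = equivRealProdLm.symm a
  finish : c.2 c.1 = equivRealProdLm.symm b
  subset : ∀ i < c.1, ∀ x ∈ segment ℝ (c.2 i) (c.2 (i + 1)), equivRealProdLm x ∈ A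
  ne : ∀ i < c.1, c.2 i ≠ c.2 (i + 1)
  cross : ∀ i j, i < j → j < c.1 → ∀ x, x ∈ segment ℝ (c.2 i) (c.2 (i + 1)) →
    x ∈ segment ℝ (c.2 j) (c.2 (j + 1)) → j = i + 1 ∧ x = c.2 j

theorem IsPolygonalArc.exists_chain {A : Set (ℝ × ℝ)} {a b : ℝ × ℝ} (h : IsPolygonalArc A a b) :
    ∃ c, IsPolygonalChain A a b c := by
  obtain ⟨n, p, hn, h0, h1, hA, hne, hc⟩ := h
  have hseg : ∀ i x, x ∈ segment ℝ (equivRealProdLm.symm (p i)) (equivRealProdLm.symm (p (i + 1)))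
      → equivRealProdLm x ∈ segment ℝ (p i) (p (i + 1)) := by
    rintro i x ⟨s, t, hs, ht, hst, rfl⟩
    exact ⟨s, t, hs, ht, hst, by simp only [map_add, map_smul, LinearEquiv.apply_symm_apply]⟩
  refine ⟨⟨n, fun i => equivRealProdLm.symm (p i)⟩, hn, by simp only [h0], by simp only [h1],
    fun i hi x hx => hA ▸ ⟨i, hi, hseg i x hx⟩,
    fun i hi h => hne i hi (equivRealProdLm.symm.injective h), fun i j hij hj x hx hx' => ?_⟩
  obtain ⟨h1, h2⟩ := hc i j hij hj _ (hseg i x hx) (hseg j x hx')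
  exact ⟨h1, by simp only [← h2, LinearEquiv.symm_apply_apply]⟩

theorem IsPolygonalChain.reverse {A : Set (ℝ × ℝ)} {a b : ℝ × ℝ} {c : ℕ × (ℕ → ℂ)}
    (h : IsPolygonalChain A a b c) :
    IsPolygonalChain A b a (c.1, fun i => c.2 (c.1 - i)) := by
  have hidx : ∀ i < c.1, ∃ k < c.1, c.1 - i = k + 1 ∧ c.1 - (i + 1) = k ∧ k = c.1 - 1 - i :=
    fun i hi => ⟨c.1 - 1 - i, by omega, by omega, by omega, rfl⟩
  refine ⟨h.pos, by simp [h.finish], by simp [h.start], fun i hi x hx => ?_, fun i hi he => ?_,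
    fun i j hij hj x hx hx' => ?_⟩
  · obtain ⟨k, hk, h1, h2, -⟩ := hidx i hi
    simp only [h1, h2] at hx
    rw [segment_symm] at hx
    exact h.subset k hk x hx
  · obtain ⟨k, hk, h1, h2, -⟩ := hidx i hi
    simp only [h1, h2] at he
    exact h.ne k hk he.symm
  · dsimp only at hj
    obtain ⟨k, hk, h1, h2, h3⟩ := hidx i (hij.trans hj)
    obtain ⟨l, hl, h1', h2', h3'⟩ := hidx j hj
    simp only [h1, h2, h1', h2'] at hx hx' ⊢
    rw [segment_symm] at hx hx'
    obtain ⟨h4, h5⟩ := h.cross l k (by omega) hk x hx' hx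
    exact ⟨by omega, h4 ▸ h5⟩

theorem SimpleGraph.PlaneDrawing.nonempty_polygonalDrawing {V : Type*} {G : SimpleGraph V}
    (D : G.PlaneDrawing) : Nonempty G.PolygonalDrawing := by
  obtain ⟨f, hf, hsymm⟩ := exists_dart_choice (G := G)
    (fun c : ℕ × (ℕ → ℂ) => (c.1, fun i => c.2 (c.1 - i)))
    (fun d c => IsPolygonalChain (D.arc d.edge) (D.point d.fst) (D.point d.snd) c)
    (fun d => (D.isPolygonalArc _ _ d.adj).exists_chain)
    (fun d c h => by rw [Dart.edge_symm]; exact h.reverse)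
  have hlen : ∀ d, (f d.symm).1 = (f d).1 := fun d => by
    rcases hsymm d with h | h <;> rw [h]
  exact ⟨{
    point := fun v => equivRealProdLm.symm (D.point v)
    point_injective := equivRealProdLm.symm.injective.comp D.point_injective
    len := fun d => (f d).1
    corner := fun d => (f d).2
    len_pos := fun d => (hf d).pos
    corner_zero := fun d => (hf d).start
    corner_len := fun d => (hf d).finish
    len_symm := hlen
    corner_symm := fun d i hi => by
      rcases hsymm d with h | h
      · rw [h]
      · have h1 : (f d).2 ((f d).1 - i) = (f d.symm).2 ((f d.symm).1 - ((f d).1 - i)) :=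
          congrArg (fun c : ℕ × (ℕ → ℂ) => c.2 ((f d).1 - i)) h
        rw [h1, hlen, Nat.sub_sub_self hi]
    corner_ne := fun d => (hf d).ne
    self_cross := fun d => (hf d).cross
    cross := fun d e hde i j hi hj x hx hx' => by
      obtain ⟨w, h1, h2, h3⟩ := D.eq_point_of_mem _ d.edge_mem _ e.edge_mem hde _
        ((hf d).subset i hi x hx) ((hf e).subset j hj x hx')
      exact ⟨w, h1, h2, by rw [← h3, LinearEquiv.symm_apply_apply]⟩ }⟩

end PolygonalChain

/-! ### The segment system of a drawing -/

namespace SimpleGraph.PolygonalDrawing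

variable {V : Type*} {G : SimpleGraph V} (D : G.PolygonalDrawing)

theorem corner_injective (d : G.Dart) {i j : ℕ} (hi : i ≤ D.len d) (hj : j ≤ D.len d)
    (h : D.corner d i = D.corner d j) : i = j := by
  by_contra hne
  wlog hij : i < j generalizing i j
  · exact this hj hi h.symm (Ne.symm hne) (by omega)
  have hi' : i < D.len d := by omega
  rcases hj.lt_or_eq with hj' | hj'
  · obtain ⟨h1, h2⟩ := D.self_cross d i j hij hj' _ (left_mem_segment ℝ _ _)
      (h ▸ left_mem_segment ℝ _ _)
    exact D.corner_ne d i hi' (h1 ▸ h2)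
  -- No segment starts at the last corner, so the one that ends there is used.
  obtain ⟨m, rfl⟩ : ∃ m, j = m + 1 := ⟨j - 1, by omega⟩
  rcases (Nat.lt_succ_iff.1 hij).lt_or_eq with h1 | h1
  · obtain ⟨-, h3⟩ := D.self_cross d i m h1 (by omega) _ (left_mem_segment ℝ _ _)
      (h ▸ right_mem_segment ℝ _ _)
    exact D.corner_ne d m (by omega) (h3.symm.trans h)
  · exact D.corner_ne d i hi' (h1 ▸ h)

theorem corner_eq_point {d : G.Dart} {i : ℕ} {w : V} (hi : i ≤ D.len d)
    (hw : w ∈ d.edge) (h : D.corner d i = D.point w) :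
    (i = 0 ∧ w = d.fst) ∨ (i = D.len d ∧ w = d.snd) := by
  have : w = d.fst ∨ w = d.snd := Sym2.mem_iff.1 hw
  rcases this with rfl | rfl
  · exact Or.inl ⟨D.corner_injective d hi (Nat.zero_le _) (h.trans (D.corner_zero d).symm), rfl⟩
  · exact Or.inr ⟨D.corner_injective d hi le_rfl (h.trans (D.corner_len d).symm), rfl⟩

theorem point_mem_segment {d : G.Dart} {i : ℕ} {w : V} (hi : i < D.len d)
    (hw : w ∈ d.edge) (h : D.point w ∈ segment ℝ (D.corner d i) (D.corner d (i + 1))) :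
    D.point w = D.corner d i ∨ D.point w = D.corner d (i + 1) := by
  have : w = d.fst ∨ w = d.snd := Sym2.mem_iff.1 hw
  rcases this with rfl | rfl
  · rcases Nat.eq_zero_or_pos i with rfl | h0
    · exact Or.inl (D.corner_zero d).symm
    · rw [← D.corner_zero] at h ⊢
      exact Or.inl (D.self_cross d 0 i h0 hi _ (left_mem_segment ℝ _ _) h).2
  · rcases (Nat.succ_le_of_lt hi).lt_or_eq with h0 | h0
    · obtain ⟨m, hm⟩ : ∃ m, D.len d = m + 1 := ⟨D.len d - 1, by omega⟩
      rw [← D.corner_len, hm] at h ⊢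
      obtain ⟨h1, h2⟩ := D.self_cross d i m (by omega) (by omega) _ h (right_mem_segment ℝ _ _)
      exact Or.inr (h1 ▸ h2)
    · exact Or.inr ((D.corner_len d).symm.trans (congrArg _ h0.symm))

/-- The oriented segments of a drawing. -/
abbrev Piece : Type _ := (d : G.Dart) × Fin (D.len d)

theorem piece_ext {x y : D.Piece} (h : x.1 = y.1) (h' : x.2.val = y.2.val) : x = y := by
  obtain ⟨d, i⟩ := x
  obtain ⟨e, j⟩ := y
  obtain rfl : d = e := h
  obtain rfl : i = j := Fin.ext h'
  rfl

/-- The reversal of an oriented segment of a drawing. -/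
def pieceInv (x : D.Piece) : D.Piece :=
  ⟨x.1.symm, ⟨D.len x.1 - 1 - x.2, by have := D.len_pos x.1; rw [D.len_symm]; omega⟩⟩

theorem corner_pieceInv (x : D.Piece) :
    D.corner (D.pieceInv x).1 (D.pieceInv x).2 = D.corner x.1 (x.2 + 1) := by
  have := x.2.isLt
  change D.corner x.1.symm (D.len x.1 - 1 - x.2) = _
  rw [D.corner_symm _ _ (by omega)]
  congr 1
  omega

/-- The straight segments that make up a drawing with polygonal arcs. -/
def segmentSystem : SegmentSystem D.Piece where
  src x := D.corner x.1 x.2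
  inv := D.pieceInv
  inv_inv x := by
    refine D.piece_ext (Dart.symm_symm _) ?_
    change D.len x.1.symm - 1 - (D.len x.1 - 1 - x.2) = _
    have := x.2.isLt
    rw [D.len_symm]
    omega
  src_ne x := by
    rw [corner_pieceInv]
    exact D.corner_ne _ _ x.2.isLt
  cross := by
    intro x y p hx hy
    rw [corner_pieceInv] at hx hy ⊢
    rw [corner_pieceInv]
    by_cases hxy : x.1.edge = y.1.edge
    · have same : ∀ y : D.Piece, y.1 = x.1 →
          p ∈ segment ℝ (D.corner y.1 y.2) (D.corner y.1 (y.2 + 1)) →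
          y = x ∨ ((p = D.corner x.1 x.2 ∨ p = D.corner x.1 (x.2 + 1)) ∧
            (p = D.corner y.1 y.2 ∨ p = D.corner y.1 (y.2 + 1))) := by
        rintro ⟨e, j⟩ hye hy
        obtain rfl : e = x.1 := hye
        rcases lt_trichotomy x.2.val j.val with h | h | h
        · obtain ⟨h1, h2⟩ := D.self_cross _ _ _ h j.isLt p hx hy
          exact Or.inr ⟨Or.inr (h1 ▸ h2), Or.inl h2⟩
        · exact Or.inl (D.piece_ext rfl h.symm)
        · obtain ⟨h1, h2⟩ := D.self_cross _ _ _ h x.2.isLt p hy hx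
          exact Or.inr ⟨Or.inl h2, Or.inr (h1 ▸ h2)⟩
      rcases dart_edge_eq_iff _ _ |>.1 hxy with h | h
      · rcases same y h.symm hy with h1 | h1
        · exact Or.inl h1
        · exact Or.inr (Or.inr h1)
      · have h' : (D.pieceInv y).1 = x.1 := by rw [h]; rfl
        have e1 := D.corner_pieceInv y
        have e2 : D.corner (D.pieceInv y).1 ((D.pieceInv y).2 + 1) = D.corner y.1 y.2 := by
          have := y.2.isLt
          change D.corner y.1.symm (D.len y.1 - 1 - y.2 + 1) = _
          rw [D.corner_symm _ _ (by omega)]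
          congr 1
          omega
        rcases same (D.pieceInv y) h' (by rw [e1, e2, segment_symm]; exact hy) with h1 | h1
        · right; left
          rw [← h1]
          refine D.piece_ext (Dart.symm_symm _).symm ?_
          change _ = D.len y.1.symm - 1 - (D.len y.1 - 1 - y.2)
          have := y.2.isLt
          rw [D.len_symm]
          omega
        · rw [e1, e2] at h1
          exact Or.inr (Or.inr ⟨h1.1, h1.2.symm⟩)
    · obtain ⟨w, h1, h2, rfl⟩ := D.cross _ _ hxy _ _ x.2.isLt y.2.isLt p hx hy
      exact Or.inr (Or.inr ⟨D.point_mem_segment x.2.isLt h1 hx,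
        D.point_mem_segment y.2.isLt h2 hy⟩)

end SimpleGraph.PolygonalDrawing

/-! ### Rotation systems and potentials -/

/-- A rotation system of a plane graph: the next dart around a vertex. Each circulation is the
difference of the values of a function on the darts, constant on faces, on the two sides of the
edges; this is how planarity enters. -/
structure SimpleGraph.PlaneRotation {V : Type*} (G : SimpleGraph V) [Fintype V]
    [DecidableRel G.Adj] where
  next : G.Dart → G.Dart
  next_fst : ∀ d, (next d).fst = d.fst
  next_ne : ∀ d, next d ≠ d
  next_next_ne : ∀ d, next (next d) ≠ d
  exists_potential : ∀ z : G.Dart → ℝ, (∀ d, z d.symm = -z d) →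
    (∀ g : V → ℝ, ∑ d, z d * g d.fst = 0) →
      ∃ c : G.Dart → ℝ, (∀ d, c d - c d.symm = z d) ∧ ∀ d, c (next d).symm = c d

namespace SimpleGraph.PolygonalDrawing

variable {V : Type*} {G : SimpleGraph V} (D : G.PolygonalDrawing)

/-- The first segment of the arc of a dart. -/
def first (d : G.Dart) : D.Piece := ⟨d, ⟨0, D.len_pos d⟩⟩

theorem src_first (d : G.Dart) : D.segmentSystem.src (D.first d) = D.point d.fst :=
  D.corner_zero d

theorem first_injective : Function.Injective D.first := fun _ _ h => congrArg Sigma.fst h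

theorem src_first_eq_iff {d e : G.Dart} :
    D.segmentSystem.src (D.first d) = D.segmentSystem.src (D.first e) ↔ e.fst = d.fst := by
  rw [src_first, src_first, D.point_injective.eq_iff, eq_comm]

theorem eq_first_of_src_eq {x : D.Piece} {d : G.Dart}
    (h : D.segmentSystem.src x = D.point d.fst) : ∃ e : G.Dart, e.fst = d.fst ∧ x = D.first e := by
  have hx := x.2.isLt
  have h' : D.corner x.1 x.2 = D.point d.fst := h
  have hmem : d.fst ∈ x.1.edge := by
    by_cases hxd : x.1.edge = d.edge
    · rw [hxd]; exact Sym2.mem_iff.2 (Or.inl rfl)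
    · obtain ⟨w, h1, -, h2⟩ := D.cross x.1 d hxd x.2 0 hx (D.len_pos d) _
        (left_mem_segment ℝ _ _) (by rw [h', D.corner_zero]; exact left_mem_segment ℝ _ _)
      rwa [← D.point_injective (h'.symm.trans h2)] at h1
  rcases D.corner_eq_point hx.le hmem h' with ⟨h1, h2⟩ | ⟨h1, -⟩
  · exact ⟨x.1, h2.symm, D.piece_ext rfl h1⟩
  · omega

theorem eq_or_eq_of_src_eq {x : D.Piece} {d : G.Dart} {i : ℕ} (hi : i + 1 < D.len d)
    (h : D.segmentSystem.src x = D.corner d (i + 1)) :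
    x = ⟨d, ⟨i + 1, hi⟩⟩ ∨ x = D.pieceInv ⟨d, ⟨i, Nat.lt_of_succ_lt hi⟩⟩ := by
  obtain ⟨e, j, hx⟩ := x
  have h' : D.corner e j = D.corner d (i + 1) := h
  by_cases hxd : e.edge = d.edge
  · rcases (dart_edge_eq_iff _ _).1 hxd with h1 | h1
    · refine Or.inl (D.piece_ext h1 ?_)
      change e = d at h1
      rw [h1] at h' hx
      exact D.corner_injective d hx.le hi.le h'
    · refine Or.inr (D.piece_ext h1 ?_)
      change j = D.len d - 1 - i
      change e = d.symm at h1
      rw [h1, D.len_symm] at hx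
      rw [h1, D.corner_symm _ _ hx.le] at h'
      have := D.corner_injective d (Nat.sub_le _ _) hi.le h'
      omega
  · obtain ⟨w, -, h1, h2⟩ := D.cross e d hxd j (i + 1) hx hi _
      (left_mem_segment ℝ _ _) (by rw [h']; exact left_mem_segment ℝ _ _)
    rcases D.corner_eq_point hi.le h1 (h'.symm.trans h2) with ⟨h3, -⟩ | ⟨h3, -⟩ <;> omega

/-- At an inner corner of an arc the pieces of `d` and `d.symm` cancel; at vertices the law for `z`
remains. -/
theorem isCirculation [Fintype V] [DecidableRel G.Adj] {z : G.Dart → ℝ} (hz : ∀ d, z d.symm = -z d)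
    (hz' : ∀ g : V → ℝ, ∑ d, z d * g d.fst = 0) :
    D.segmentSystem.IsCirculation (fun x => z x.1) := by
  refine ⟨fun x => hz _, fun g => ?_⟩
  rw [Fintype.sum_sigma]
  have h1 : ∀ d, ∑ i : Fin (D.len d), z d * g (D.segmentSystem.src ⟨d, i⟩) =
      z d * g (D.point d.fst) + z d * ∑ i ∈ Finset.range (D.len d - 1), g (D.corner d (i + 1)) := by
    intro d
    obtain ⟨m, hm⟩ : ∃ m, D.len d = m + 1 := ⟨D.len d - 1, by have := D.len_pos d; omega⟩
    rw [← Finset.mul_sum, ← mul_add]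
    congr 1
    refine (Fin.sum_univ_eq_sum_range (fun i => g (D.corner d i)) (D.len d)).trans ?_
    rw [hm, Finset.sum_range_succ', D.corner_zero, add_comm]
    rfl
  have h2 : ∀ d, ∑ i ∈ Finset.range (D.len d.symm - 1), g (D.corner d.symm (i + 1)) =
      ∑ i ∈ Finset.range (D.len d - 1), g (D.corner d (i + 1)) := by
    intro d
    rw [← Finset.sum_range_reflect, D.len_symm]
    refine Finset.sum_congr rfl fun i hi => ?_
    rw [Finset.mem_range] at hi
    rw [D.corner_symm _ _ (by omega)]
    congr 2
    omega
  have h3 := Equiv.sum_comp (Function.Involutive.toPerm _ (Dart.symm_involutive (G := G)))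
    (fun d => z d * ∑ i ∈ Finset.range (D.len d - 1), g (D.corner d (i + 1)))
  simp only [Function.Involutive.coe_toPerm, hz, h2, neg_mul, Finset.sum_neg_distrib] at h3
  simp only [h1, Finset.sum_add_distrib, hz' (fun v => g (D.point v))]
  linarith

theorem nonempty_planeRotation [Fintype V] [DecidableEq V] [DecidableRel G.Adj]
    (D : G.PolygonalDrawing) (hdeg : ∀ d : G.Dart, 3 ≤ G.degree d.fst) :
    Nonempty G.PlaneRotation := by
  set S := D.segmentSystem with hS
  have hex : ∀ d : G.Dart, ∃ e : G.Dart, (e.fst = d.fst ∧ e ≠ d) ∧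
      ∀ k : G.Dart, k.fst = d.fst → k ≠ d →
        S.angle (D.first d) (D.first e) ≤ S.angle (D.first d) (D.first k) := by
    intro d
    have hcard : 1 < (Finset.univ.filter fun e : G.Dart => e.fst = d.fst).card := by
      rw [dart_fst_fiber_card_eq_degree]; have := hdeg d; omega
    obtain ⟨e, he, hne⟩ := Finset.exists_mem_ne hcard d
    obtain ⟨m, hm, hmin⟩ := Finset.exists_min_image
      (Finset.univ.filter fun e : G.Dart => e.fst = d.fst ∧ e ≠ d)
      (fun e => S.angle (D.first d) (D.first e)) ⟨e, by simpa [hne] using he⟩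
    simp only [Finset.mem_filter, Finset.mem_univ, true_and] at hm hmin
    exact ⟨m, hm, fun k h1 h2 => hmin k ⟨h1, h2⟩⟩
  choose σ hσ hmin using hex
  refine ⟨⟨σ, fun d => (hσ d).1, fun d => (hσ d).2, fun d h => ?_, fun z hz hz' => ?_⟩⟩
  -- This is where degree at least 3 is needed: a third dart lies on one of the two sides between
  -- `d` and `σ d`.
  · obtain ⟨k, hk, hkd, hks⟩ : ∃ k : G.Dart, k.fst = d.fst ∧ k ≠ d ∧ k ≠ σ d := by
      have hcard : 2 < (Finset.univ.filter fun e : G.Dart => e.fst = d.fst).card := by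
        rw [dart_fst_fiber_card_eq_degree]; have := hdeg d; omega
      obtain ⟨k, hk, hk'⟩ := Finset.exists_mem_notMem_of_card_lt_card
        (lt_of_le_of_lt (Finset.card_le_two (a := d) (b := σ d)) hcard)
      simp only [Finset.mem_filter, Finset.mem_univ, true_and, Finset.mem_insert,
        Finset.mem_singleton, not_or] at hk hk'
      exact ⟨k, hk, hk'.1, hk'.2⟩
    have h2 := hmin (σ d) k (hk.trans (hσ d).1.symm) hks
    rw [h] at h2
    exact hkd (D.first_injective (SegmentSystem.eq_of_angle_le
      (D.src_first_eq_iff.2 (hσ d).1) (D.src_first_eq_iff.2 hk)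
      (fun h => (hσ d).2 (D.first_injective h)) (fun h => hks (D.first_injective h))
      (hmin d k hk hkd) h2))
  have hcirc := D.isCirculation hz hz'
  set c : D.Piece → ℝ := S.left fun x => z x.1 with hc
  -- Only two segments start at an inner corner, so each is the successor of the other and the left
  -- side continues past the corner.
  have along : ∀ (d : G.Dart) (i : ℕ) (hi : i < D.len d), c ⟨d, ⟨i, hi⟩⟩ = c (D.first d) := by
    intro d i
    induction i with
    | zero => intro _; rfl
    | succ i ih =>
      intro hi
      have hi' := Nat.lt_of_succ_lt hi
      rw [← ih hi']
      have hsrc : S.src ⟨d, ⟨i + 1, hi⟩⟩ = S.src (D.pieceInv ⟨d, ⟨i, hi'⟩⟩) :=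
        (D.corner_pieceInv ⟨d, ⟨i, hi'⟩⟩).symm
      have := hcirc.left_inv_eq hsrc fun k hk => by
        rcases D.eq_or_eq_of_src_eq hi hk.symm with h | h
        · rw [h, SegmentSystem.angle_self]; exact SegmentSystem.angle_le _ _
        · rw [h]
      refine this.symm.trans ?_
      exact congrArg c (D.segmentSystem.inv_inv _)
  have hpos := Real.pi_pos
  refine ⟨fun d => c (D.first d) / (2 * Real.pi), fun d => ?_, fun d => ?_⟩
  · have hl : D.len d - 1 < D.len d := by have := D.len_pos d; omega
    have h1 := hcirc.left_sub_left_inv ⟨d, ⟨D.len d - 1, hl⟩⟩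
    have h2 : S.inv ⟨d, ⟨D.len d - 1, hl⟩⟩ = D.first d.symm := by
      refine D.piece_ext rfl ?_
      change D.len d - 1 - (D.len d - 1) = 0
      omega
    rw [← hS, ← hc, along d _ hl, h2] at h1
    rw [← sub_div, h1]
    field_simp
  · have h1 := hcirc.left_inv_eq (D.src_first_eq_iff.2 (hσ d).1) fun k hk => by
      obtain ⟨e, he, rfl⟩ := D.eq_first_of_src_eq (hk.symm.trans (D.src_first d))
      by_cases hed : e = d
      · rw [hed, SegmentSystem.angle_self]; exact SegmentSystem.angle_le _ _
      · exact hmin d e he hed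
    have hl : D.len (σ d).symm - 1 < D.len (σ d).symm := by
      have := D.len_pos (σ d).symm; omega
    have h2 : S.inv (D.first (σ d)) = ⟨(σ d).symm, ⟨D.len (σ d).symm - 1, hl⟩⟩ := by
      refine D.piece_ext rfl ?_
      change D.len (σ d) - 1 - 0 = D.len (σ d).symm - 1
      rw [D.len_symm]; omega
    rw [← hS, ← hc, h2, along] at h1
    exact congrArg (· / (2 * Real.pi)) h1

end SimpleGraph.PolygonalDrawing

/-! ### Faces and Euler's inequality -/

namespace SimpleGraph.PlaneRotation

open Finset

variable {V : Type*} {G : SimpleGraph V} [Fintype V] [DecidableRel G.Adj] (R : G.PlaneRotation)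

/-- The dart that precedes `d` on the boundary of a face. -/
def prev (d : G.Dart) : G.Dart := (R.next d).symm

theorem prev_snd (d : G.Dart) : (R.prev d).snd = d.fst := R.next_fst d

/-- A face walk never turns straight back. This makes all faces have at least three darts. -/
theorem prev_fst_ne (d : G.Dart) : (R.prev d).fst ≠ d.snd := fun h =>
  R.next_ne d (Dart.ext _ _ (Prod.ext (R.next_fst d) h))

theorem prev_ne (d : G.Dart) : R.prev d ≠ d := fun h =>
  d.adj.ne (by rw [← R.prev_snd d, h])

theorem prev_prev_ne (d : G.Dart) : R.prev (R.prev d) ≠ d := fun h =>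
  R.prev_fst_ne d (by rw [← R.prev_snd (R.prev d), h])

/-- Darts are equivalent if they belong to the same face. -/
def faceSetoid : Setoid G.Dart := Relation.EqvGen.setoid fun d e => e = R.prev d

/-- The faces of a plane graph. -/
abbrev Face : Type _ := Quotient R.faceSetoid

/-- The face of a dart. -/
def face (d : G.Dart) : R.Face := Quotient.mk _ d

theorem face_prev (d : G.Dart) : R.face (R.prev d) = R.face d :=
  (Quotient.sound (s := R.faceSetoid) (Relation.EqvGen.rel d (R.prev d) rfl)).symm

theorem face_surjective : Function.Surjective R.face := Quotient.mk_surjective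

theorem exists_face_function {α : Type*} {c : G.Dart → α} (h : ∀ d, c (R.prev d) = c d) :
    ∃ f : R.Face → α, ∀ d, f (R.face d) = c d := by
  refine ⟨Quotient.lift c fun a b hab => ?_, fun _ => rfl⟩
  induction hab with
  | rel x y hxy => rw [hxy, h]
  | refl x => rfl
  | symm x y _ ih => exact ih.symm
  | trans x y z _ _ ih1 ih2 => exact ih1.trans ih2

open Classical in
noncomputable instance : Fintype R.Face := Fintype.ofSurjective R.face R.face_surjective

/-- The part of Euler's formula that planarity contributes. -/
theorem card_edges_lt [DecidableEq V] (hG : Nonempty G.Dart) :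
    #G.edgeFinset < Fintype.card R.Face + #{v | 0 < G.degree v} := by
  -- The kernel of `L` consists of the circulations: antisymmetry is one equation per edge,
  -- Kirchhoff's law one per nonisolated vertex.
  let L : (G.Dart → ℝ) →ₗ[ℝ] (G.edgeFinset → ℝ) × ({v // 0 < G.degree v} → ℝ) :=
    { toFun := fun z => (fun e => ∑ d with d.edge = e.1, z d, fun v => ∑ d with d.fst = v.1, z d)
      map_add' := fun x y => by
        ext <;> simp [sum_add_distrib]
      map_smul' := fun r x => by
        ext <;> simp [mul_sum] }
  let A : (R.Face → ℝ) →ₗ[ℝ] (G.Dart → ℝ) :=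
    { toFun := fun f d => f (R.face d) - f (R.face d.symm)
      map_add' := fun x y => by
        ext; simp only [Pi.add_apply]; ring
      map_smul' := fun r x => by
        ext; simp only [Pi.smul_apply, smul_eq_mul, RingHom.id_apply]; ring }
  have hle : LinearMap.ker L ≤ LinearMap.range A := by
    intro z hz
    rw [LinearMap.mem_ker, Prod.ext_iff] at hz
    obtain ⟨h1, h2⟩ := hz
    have hanti : ∀ d, z d.symm = -z d := fun d => by
      have := congrFun h1 ⟨d.edge, by simp⟩
      change ∑ d' with d'.edge = d.edge, z d' = 0 at this
      rw [d.edge_fiber, sum_pair d.symm_ne.symm] at this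
      linarith
    have hcirc : ∀ g : V → ℝ, ∑ d, z d * g d.fst = 0 := fun g => by
      rw [← sum_fiberwise univ (fun d : G.Dart => d.fst)]
      refine sum_eq_zero fun v _ => ?_
      have h3 : ∑ d with d.fst = v, z d * g d.fst = (∑ d with d.fst = v, z d) * g v := by
        rw [sum_mul]
        refine sum_congr rfl fun d hd => ?_
        rw [(mem_filter.1 hd).2]
      rw [h3]
      rcases Nat.eq_zero_or_pos (G.degree v) with h0 | h0
      · rw [← dart_fst_fiber_card_eq_degree, card_eq_zero] at h0
        rw [h0, sum_empty, zero_mul]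
      · have : ∑ d with d.fst = v, z d = 0 := congrFun h2 ⟨v, h0⟩
        rw [this, zero_mul]
    obtain ⟨c, hc, hc'⟩ := R.exists_potential z hanti hcirc
    obtain ⟨f, hf⟩ := R.exists_face_function hc'
    exact ⟨f, funext fun d => by rw [← hc, ← hf, ← hf]; rfl⟩
  have hker : 0 < Module.finrank ℝ (LinearMap.ker A) := by
    obtain ⟨d⟩ := hG
    have : (⟨fun _ => 1, by ext; simp [A]⟩ : LinearMap.ker A) ≠ 0 := fun h => by
      have := congrFun (congrArg Subtype.val h) (R.face d)
      simp at this
    have : Nontrivial (LinearMap.ker A) := ⟨_, _, this⟩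
    exact Module.finrank_pos
  -- Rank counting: 2E - (E + V') ≤ dim ker L ≤ dim range A ≤ F - 1.
  have h1 := A.finrank_range_add_finrank_ker
  have h2 := L.finrank_range_add_finrank_ker
  have h3 := Submodule.finrank_mono hle
  have h4 := Submodule.finrank_le (LinearMap.range L)
  rw [Module.finrank_prod, Module.finrank_fintype_fun_eq_card, Module.finrank_fintype_fun_eq_card,
    Fintype.card_coe, Fintype.card_subtype] at h4
  rw [Module.finrank_fintype_fun_eq_card] at h1 h2
  rw [G.dart_card_eq_twice_card_edges] at h2
  omega

/-! ### Triangular faces and discharging -/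

open Classical in
/-- The darts of a face. -/
noncomputable def boundary (f : R.Face) : Finset G.Dart := {d | R.face d = f}

theorem mem_boundary {f : R.Face} {d : G.Dart} : d ∈ R.boundary f ↔ R.face d = f := by
  simp [boundary]

theorem subset_boundary [DecidableEq V] (d : G.Dart) :
    {d, R.prev d, R.prev (R.prev d)} ⊆ R.boundary (R.face d) := by
  intro e he
  simp only [mem_insert, mem_singleton] at he
  rcases he with rfl | rfl | rfl <;> simp only [mem_boundary, face_prev]

theorem card_triple [DecidableEq V] (d : G.Dart) : #{d, R.prev d, R.prev (R.prev d)} = 3 :=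
  card_eq_three.2 ⟨_, _, _, (R.prev_ne d).symm, (R.prev_prev_ne d).symm,
    (R.prev_ne (R.prev d)).symm, rfl⟩

theorem three_le_card_boundary (f : R.Face) : 3 ≤ #(R.boundary f) := by
  classical
  obtain ⟨d, rfl⟩ := R.face_surjective f
  exact (R.card_triple d).symm.le.trans (card_le_card (R.subset_boundary d))

theorem boundary_eq [DecidableEq V] {d : G.Dart} (h : #(R.boundary (R.face d)) = 3) :
    R.boundary (R.face d) = {d, R.prev d, R.prev (R.prev d)} :=
  (eq_of_subset_of_card_le (R.subset_boundary d) (by rw [h, R.card_triple])).symm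

theorem prev_prev_prev {d : G.Dart} (h : #(R.boundary (R.face d)) = 3) :
    R.prev (R.prev (R.prev d)) = d := by
  classical
  have h1 : R.prev (R.prev (R.prev d)) ∈ R.boundary (R.face d) := by
    simp only [mem_boundary, face_prev]
  rw [R.boundary_eq h] at h1
  simp only [mem_insert, mem_singleton] at h1
  rcases h1 with h1 | h1 | h1
  · exact h1
  · exact absurd h1 (R.prev_prev_ne _)
  · exact absurd h1 (R.prev_ne _)

theorem prev_prev_fst {d : G.Dart} (h : #(R.boundary (R.face d)) = 3) :
    (R.prev (R.prev d)).fst = d.snd := by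
  rw [← R.prev_snd (R.prev (R.prev d)), R.prev_prev_prev h]

/-- In a graph without kites, a triangular face does not lie on both sides of an edge, nor do two
triangular faces share an edge. -/
theorem card_boundary_symm_ne (hkite : ¬ G.HasKite) {d : G.Dart}
    (h : #(R.boundary (R.face d)) = 3) : #(R.boundary (R.face d.symm)) ≠ 3 := by
  intro h'
  have a1 := (R.prev d).adj
  have a2 := (R.prev (R.prev d)).adj
  have b1 := (R.prev d.symm).adj
  have b2 := (R.prev (R.prev d.symm)).adj
  rw [R.prev_snd] at a1 a2 b1 b2
  rw [R.prev_prev_fst h] at a2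
  rw [R.prev_prev_fst h'] at b2
  -- Different third corners would form a kite; a common one would be a vertex where `next` has a
  -- 2-cycle.
  have hx : (R.prev d).fst = (R.prev d.symm).fst := by
    by_contra hne
    exact hkite ⟨d.fst, d.snd, _, _, hne, d.adj, a1.symm, a2, b2, b1.symm⟩
  have e1 : R.next (R.prev d) = R.prev d.symm := by
    refine Dart.ext _ _ (Prod.ext ((R.next_fst _).trans hx) ?_)
    exact (R.prev_prev_fst h).trans (R.prev_snd d.symm).symm
  have e2 : R.next (R.prev d.symm) = R.prev d := by
    refine Dart.ext _ _ (Prod.ext ((R.next_fst _).trans hx.symm) ?_)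
    exact (R.prev_prev_fst h').trans (R.prev_snd d).symm
  exact R.next_next_ne (R.prev d) (by rw [e1, e2])

theorem two_mul_card_triangular_le [DecidableEq V] (hkite : ¬ G.HasKite) (v : V) :
    2 * #{d : G.Dart | #(R.boundary (R.face d)) = 3 ∧ d.fst = v} ≤ G.degree v := by
  set A : Finset G.Dart := {d | #(R.boundary (R.face d)) = 3 ∧ d.fst = v} with hA
  have hmem : ∀ {d}, d ∈ A ↔ #(R.boundary (R.face d)) = 3 ∧ d.fst = v := by simp [hA]
  -- `next` is not assumed injective; on triangular faces it is, since three steps of `prev` return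
  -- to the start.
  have hinj : Set.InjOn R.next A := fun d hd e he hde => by
    rw [← R.prev_prev_prev (hmem.1 hd).1, ← R.prev_prev_prev (hmem.1 he).1, prev, prev, prev, prev,
      prev, prev, hde]
  -- The edge of `next e` has the face of `e` on its other side, so both being triangular is
  -- excluded.
  have hdisj : Disjoint A (A.image R.next) := by
    rw [Finset.disjoint_left]
    intro d hd hd'
    obtain ⟨e, he, rfl⟩ := mem_image.1 hd'
    refine R.card_boundary_symm_ne hkite (hmem.1 hd).1 ?_
    exact (congrArg (fun f => #(R.boundary f)) (R.face_prev e)).trans (hmem.1 he).1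
  rw [← dart_fst_fiber_card_eq_degree, two_mul]
  nth_rewrite 2 [← card_image_of_injOn hinj]
  rw [← card_union_of_disjoint hdisj]
  refine card_le_card fun d hd => ?_
  simp only [mem_filter, mem_univ, true_and]
  rcases mem_union.1 hd with hd | hd
  · exact (hmem.1 hd).2
  · obtain ⟨e, he, rfl⟩ := mem_image.1 hd
    exact (R.next_fst e).trans (hmem.1 he).2

/-- If the degrees of the ends of edges are at least four, a kite-free plane graph has no weighting
of the vertices that gives each triangle at least six and that gives each vertex so little that all
triangular faces at it cost at most six times its degree minus four. -/
theorem isEmpty_dart [DecidableEq V] (R : G.PlaneRotation) (hkite : ¬ G.HasKite)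
    (hdeg : ∀ v, 0 < G.degree v → 4 ≤ G.degree v)
    (w : V → ℕ) (hw : ∀ u v x, G.Adj u v → G.Adj v x → G.Adj x u → 6 ≤ w u + w v + w x)
    (hw' : ∀ v t, 2 * t ≤ G.degree v → w v * t ≤ 6 * (G.degree v - 4)) : IsEmpty G.Dart := by
  rw [← not_nonempty_iff]
  intro hG
  have heuler := R.card_edges_lt hG
  set T : Finset R.Face := {f | #(R.boundary f) = 3} with hT
  -- Each face has at least four darts, triangles excepted, which have three.
  have h1 : 4 * Fintype.card R.Face ≤ 2 * #G.edgeFinset + #T := by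
    classical
    rw [← G.dart_card_eq_twice_card_edges, ← card_univ (α := G.Dart),
      card_eq_sum_card_fiberwise (f := R.face) (t := univ) (fun _ _ => mem_coe.2 (mem_univ _)), hT,
      card_filter, ← sum_add_distrib, ← card_univ, card_eq_sum_ones, mul_sum]
    refine sum_le_sum fun f _ => ?_
    have h2 := R.three_le_card_boundary f
    have h3 : #{d | R.face d = f} = #(R.boundary f) := by
      congr 1
    rw [h3]
    split_ifs <;> omega
  have h2 : 6 * #T ≤ ∑ v, 6 * (G.degree v - 4) := calc
    6 * #T = ∑ f ∈ T, 6 := by rw [sum_const, smul_eq_mul, mul_comm]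
    _ ≤ ∑ f ∈ T, ∑ d ∈ R.boundary f, w d.fst := by
        refine sum_le_sum fun f hf => ?_
        obtain ⟨d, rfl⟩ := R.face_surjective f
        have h3 := (mem_filter.1 hf).2
        rw [R.boundary_eq h3, sum_insert, sum_pair (R.prev_ne _).symm, R.prev_prev_fst h3,
          ← add_assoc]
        · have a1 := (R.prev d).adj
          have a2 := (R.prev (R.prev d)).adj
          rw [R.prev_snd] at a1 a2
          rw [R.prev_prev_fst h3] at a2
          have := hw _ _ _ a1.symm a2.symm d.adj.symm
          exact this
        · simp only [mem_insert, mem_singleton, not_or]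
          exact ⟨(R.prev_ne d).symm, (R.prev_prev_ne d).symm⟩
    _ = ∑ d : G.Dart with #(R.boundary (R.face d)) = 3, w d.fst := by
        classical
        rw [← sum_fiberwise_of_maps_to (s := {d : G.Dart | #(R.boundary (R.face d)) = 3})
          (t := T) (g := R.face) (fun d hd => by simpa [hT] using hd)]
        refine sum_congr rfl fun f hf => sum_congr ?_ fun _ _ => rfl
        have h3 := (mem_filter.1 hf).2
        ext d
        simp only [mem_boundary, mem_filter, mem_univ, true_and]
        exact ⟨fun h => ⟨h ▸ h3, h⟩, fun h => h.2⟩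
    _ = ∑ v, w v * #{d : G.Dart | #(R.boundary (R.face d)) = 3 ∧ d.fst = v} := by
        rw [← sum_fiberwise _ (fun d : G.Dart => d.fst)]
        refine sum_congr rfl fun v _ => ?_
        rw [filter_filter, sum_congr rfl (g := fun _ => w v), sum_const, smul_eq_mul, mul_comm]
        intro d hd
        rw [(mem_filter.1 hd).2.2]
    _ ≤ ∑ v, 6 * (G.degree v - 4) :=
        sum_le_sum fun v _ => hw' v _ (R.two_mul_card_triangular_le hkite v)
  -- Truncated subtraction gives isolated vertices the charge 0, so they are left out of the count.
  have h3 : ∑ v, 6 * (G.degree v - 4) + 24 * #{v | 0 < G.degree v} = 12 * #G.edgeFinset := by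
    rw [show 12 * #G.edgeFinset = 6 * (2 * #G.edgeFinset) by ring,
      ← G.sum_degrees_eq_twice_card_edges, mul_sum, card_filter, mul_sum, ← sum_add_distrib]
    refine sum_congr rfl fun v _ => ?_
    have := hdeg v
    split_ifs with h0
    · have := this h0; omega
    · omega
  omega

end SimpleGraph.PlaneRotation

/-! ### The two degree bounds -/

/-- Six times the charge that a vertex of degree `d` gives to each triangular face at it. -/
def dischargingWeight (d : ℕ) : ℕ := if d = 5 then 3 else if d = 6 then 4 else 0

/-- A kite-free planar graph whose nonisolated vertices have degrees 4, 5 and 6 and in which each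
triangular face receives its full charge has no edges. -/
theorem SimpleGraph.IsPlanar.isEmpty_dart {V : Type*} [Fintype V] {G : SimpleGraph V}
    [DecidableRel G.Adj] (hplanar : G.IsPlanar) (hkite : ¬ G.HasKite)
    (hdeg : ∀ v, 0 < G.degree v → 4 ≤ G.degree v ∧ G.degree v ≤ 6)
    (htri : ∀ u v x, G.Adj u v → G.Adj v x → G.Adj x u → 6 ≤ dischargingWeight (G.degree u) +
      dischargingWeight (G.degree v) + dischargingWeight (G.degree x)) : IsEmpty G.Dart := by
  classical
  obtain ⟨D⟩ := hplanar
  obtain ⟨D⟩ := D.nonempty_polygonalDrawing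
  obtain ⟨R⟩ := D.nonempty_planeRotation fun d => by
    have := (hdeg d.fst ((G.degree_pos_iff_exists_adj _).2 ⟨_, d.adj⟩)).1
    omega
  refine R.isEmpty_dart hkite (fun v hv => (hdeg v hv).1) _ htri fun v t ht => ?_
  have := hdeg v
  generalize G.degree v = d at *
  -- The budget is tight: 3 · 2 = 6 · 1 for degree 5 and 4 · 3 = 6 · 2 for degree 6.
  have hd : d = 0 ∨ d = 4 ∨ d = 5 ∨ d = 6 := by omega
  rcases hd with rfl | rfl | rfl | rfl <;> simp [dischargingWeight] <;> omega

theorem mainTheorem8 {V : Type*} [Fintype V] (G : SimpleGraph V) [DecidableRel G.Adj]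
    (hplanar : G.IsPlanar) (hkite : ¬ G.HasKite) :
    (G.maxDegree ≤ 5 → G.edgeSet.Nonempty →
      ∃ u v, G.Adj u v ∧ G.degree u + G.degree v ≤ 8) ∧
    (G.maxDegree = 6 →
      ∃ u v, G.Adj u v ∧ G.degree u + G.degree v ≤ 9) := by
  have key : ∀ m, (∀ v, G.degree v ≤ m) → (m = 5 ∨ m = 6) →
      (∀ u v, G.Adj u v → m + 4 ≤ G.degree u + G.degree v) → IsEmpty G.Dart := by
    intro m hm hm' hsum
    have hpos : ∀ v, 0 < G.degree v → 4 ≤ G.degree v ∧ G.degree v ≤ 6 := fun v hv => by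
      obtain ⟨u, hu⟩ := (G.degree_pos_iff_exists_adj v).1 hv
      have := hsum v u hu
      have := hm u
      have := hm v
      omega
    -- A triangle with a 4-vertex has two vertices of degree `m`, giving 3 + 3 or 4 + 4; otherwise
    -- all three give at least 3.
    refine hplanar.isEmpty_dart hkite hpos fun u v x huv hvx hxu => ?_
    have h1 := hsum _ _ huv
    have h2 := hsum _ _ hvx
    have h3 := hsum _ _ hxu
    have h4 := hm u
    have h5 := hm v
    have h6 := hm x
    generalize G.degree u = a at *
    generalize G.degree v = b at *
    generalize G.degree x = c at *
    unfold dischargingWeight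
    split_ifs <;> omega
  refine ⟨fun hmax hne => ?_, fun hmax => ?_⟩
  · by_contra! hcon
    obtain ⟨e, he⟩ := hne
    induction e with
    | h u v =>
      exact (key 5 (fun v => (G.degree_le_maxDegree v).trans hmax) (Or.inl rfl)
        fun u v h => hcon u v h).false ⟨(u, v), he⟩
  · by_contra! hcon
    have hV : Nonempty V := by
      by_contra h
      rw [not_nonempty_iff] at h
      simp at hmax
    obtain ⟨u, hu⟩ := G.exists_maximal_degree_vertex
    obtain ⟨v, hv⟩ := (G.degree_pos_iff_exists_adj u).1 (by omega)
    exact (key 6 (fun v => (G.degree_le_maxDegree v).trans hmax.le) (Or.inr rfl)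
      fun u v h => hcon u v h).false ⟨(u, v), hv⟩
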